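/- Let $X_n$ be a set of $n$ elements. A decision tree over $X_n$ is a binary tree whose internal nodes are labeled by subsets $q\subseteq X_n$ (questions "$x\in q$?"), with one Yes-child and one No-child, and whose leaves are labeled by distinct elements of $X_n$. It is valid for a probability distribution $\mu$ on $X_n$ if its leaf labels are exactly the elements of the support of $\mu$ and, for every $x$ in the support, answering the questions truthfully for $x$ leads to the leaf labeled $x$, whose depth is denoted $T(x)$. Its cost is $T(\mu)=\sum_x \mu(x)T(x)$. A set $\mathcal Q\subseteq 2^{X_n}$ of questions has redundancy at most $r$ if for every probability distribution $\mu$ on $X_n$ there is a decision tree valid for $\mu$, all of whose questions belong to $\mathcal Q$, of cost at most $H(\mu)+r$, where $H$ is the base-2 entropy. Let $u_H(n,r)$ be the minimum size of a set of questions $\mathcal Q\subseteq 2^{X_n}$ with redundancy at most $r$. **Theorem.** Let $r\ge 1$ be real. For every $n\in\mathbb N$ such sets of questions exist, so that $u_H(n,r)$ is well defined, and \[ u_H(n,r)\;\le\; 2\lfloor r\rfloor\, n^{1/\lfloor r\rfloor}. \] Moreover, for every $n$ with $\lfloor r\rfloor\le\lceil\log_2 n\rceil$, \[ \frac1e\,\lfloor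 r\rfloor\, n^{1/\lfloor r\rfloor}\;\le\; u_H(n,r). \] In particular, for each fixed $r\ge1$, $u_H(n,r)=\Theta\bigl(\lfloor r\rfloor n^{1/\lfloor r\rfloor}\bigr)$ as $n\to\infty$. -/

import Mathlib

namespace TwentyQuestions

/-- Decision trees over the universe `Fin n` of `n` elements. An internal node carries a
question (a set of elements), followed by its Yes-subtree and its No-subtree. A leaf carries the
element that the strategy announces. -/
inductive DecisionTree (n : ℕ) : Type
  | leaf (x : Fin n) : DecisionTree n
  | node (q : Finset (Fin n)) (yes no : DecisionTree n) : DecisionTree n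

namespace DecisionTree

variable {n : ℕ}

/-- The labels of the leaves, listed with multiplicity. -/
def leaves : DecisionTree n → List (Fin n)
  | leaf x => [x]
  | node _ yes no => yes.leaves ++ no.leaves

/-- All questions asked in the tree belong to `Q`. -/
def Uses (Q : Finset (Finset (Fin n))) : DecisionTree n → Prop
  | leaf _ => True
  | node q yes no => q ∈ Q ∧ yes.Uses Q ∧ no.Uses Q

/-- The label of the leaf that is reached when the secret element is `x` and all the questions
are answered truthfully. -/
def run : DecisionTree n → Fin n → Fin n
  | leaf y, _ => y
  | node q yes no, x => if x ∈ q then yes.run x else no.run x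

/-- The number of questions asked when the secret element is `x`. In a valid tree, for `x` in the
support, this is the number of edges from the root to the unique leaf labelled `x`. -/
def depth : DecisionTree n → Fin n → ℕ
  | leaf _, _ => 0
  | node q yes no, x => 1 + if x ∈ q then yes.depth x else no.depth x

/-- A decision tree is valid for the distribution `μ` if its leaves have distinct labels, the
labels are exactly the elements of the support of `μ`, and each element of the support is found
by the strategy. -/
structure Valid (T : DecisionTree n) (μ : Fin n → ℝ) : Prop where
  nodup_leaves : T.leaves.Nodup
  mem_leaves_iff : ∀ x, x ∈ T.leaves ↔ μ x ≠ 0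
  run_eq : ∀ x, μ x ≠ 0 → T.run x = x

/-- The average number of questions on an element drawn from `μ`. -/
def cost (T : DecisionTree n) (μ : Fin n → ℝ) : ℝ :=
  ∑ x, μ x * (T.depth x : ℝ)

end DecisionTree

/-- Base 2 entropy of a distribution on `Fin n` (with the convention `0 * log 0 = 0`). -/
noncomputable def entropy {n : ℕ} (μ : Fin n → ℝ) : ℝ :=
  ∑ x, -(μ x * Real.logb 2 (μ x))

/-- The set of questions `Q` has redundancy at most `r`: for every probability distribution there
is a valid decision tree using only questions from `Q` of cost at most the entropy plus `r`. -/
def RedundancyAtMost {n : ℕ} (Q : Finset (Finset (Fin n))) (r : ℝ) : Prop :=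
  ∀ μ ∈ stdSimplex ℝ (Fin n),
    ∃ T : DecisionTree n, T.Valid μ ∧ T.Uses Q ∧ T.cost μ ≤ entropy μ + r

/-- The possible sizes of sets of questions of redundancy at most `r` over `n` elements. -/
def redundancySizes (n : ℕ) (r : ℝ) : Set ℕ :=
  {k | ∃ Q : Finset (Finset (Fin n)), RedundancyAtMost Q r ∧ Q.card = k}

/-- `uH n r` is the minimum size of a set of questions over `n` elements with redundancy at
most `r`. -/
noncomputable def uH (n : ℕ) (r : ℝ) : ℕ :=
  sInf (redundancySizes n r)

end TwentyQuestions

/-! ### Lower estimates for binary entropy -/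

namespace TwentyQuestions

open Real

/-! Let k = ⌊r⌋. For the upper bound, write elements with k digits in base ⌈n^(1/k)⌉ and allow, for
each digit, threshold and equality questions. By the chain rule for entropy
(`identifiable_of_fibers`) it suffices to find a single digit with redundancy at most 1. With total
weight V and largest weight m, test equality with the heaviest digit if m ≥ 2V/7; otherwise cut at a
threshold whose two sides differ by at most m. The induction (`split_bound`) carries a potential,
`saving`: the entropy deficit of an unbalanced cut is paid for by the increase of the saving on the
side that keeps the heaviest digit (`cut_step`), and an equality test replenishes it
(`equality_step`).

For the lower bound, a distribution of full support with almost all its mass at x has entropy near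
0, so some tree separating all elements finds x in at most k questions (`exists_shallow_tree`).
Hence the indicator of x is a polynomial of degree at most k in the indicators of the questions.
Products of at most k of these therefore span ℝⁿ (`productSpan_eq_top`), so n is at most the number
of subsets of Q of size at most k, which is at most (e|Q|/k)^k. -/

lemma binEntropy_ge_of_half_le {p : ℝ} (h : 1 / 2 ≤ p) (h1 : p < 1) :
    (1 - p) * log 2 ≤ binEntropy p := by
  have e1 : 0 ≤ p * log p⁻¹ :=
    mul_nonneg (by linarith) (log_nonneg ((one_le_inv₀ (by linarith)).2 h1.le))
  have e2 : log 2 ≤ log (1 - p)⁻¹ := by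
    apply log_le_log two_pos
    rw [le_inv_comm₀ two_pos (by linarith)]
    linarith
  have := mul_le_mul_of_nonneg_left e2 (by linarith : 0 ≤ 1 - p)
  unfold binEntropy
  linarith

lemma binEntropy_two_sevenths : (1 - 17 / 35 * (2 / 7)) * log 2 ≤ binEntropy (2 / 7) := by
  have h7 : (87 : ℝ) * log 2 ≤ 31 * log 7 := by
    have : log ((2 : ℝ) ^ 87) ≤ log (7 ^ 31) := log_le_log (by positivity) (by norm_num)
    rw [log_pow, log_pow] at this
    exact_mod_cast this
  have h5 : (31 : ℝ) * log 5 ≤ 72 * log 2 := by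
    have : log ((5 : ℝ) ^ 31) ≤ log (2 ^ 72) := log_le_log (by positivity) (by norm_num)
    rw [log_pow, log_pow] at this
    exact_mod_cast this
  have e : binEntropy (2 / 7) = log 7 - 2 / 7 * log 2 - 5 / 7 * log 5 := by
    unfold binEntropy
    rw [show (1 - 2 / 7 : ℝ) = 5 / 7 by norm_num, log_inv, log_inv,
      log_div (by norm_num) (by norm_num), log_div (by norm_num) (by norm_num)]
    ring
  have := log_pos (one_lt_two (α := ℝ))
  rw [e]
  linarith

lemma binEntropy_four_fifths : (1 - 17 / 35 * (4 / 5)) * log 2 ≤ binEntropy (4 / 5) := by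
  have h5 : (9 : ℝ) * log 2 ≤ 4 * log 5 := by
    have : log ((2 : ℝ) ^ 9) ≤ log (5 ^ 4) := log_le_log (by positivity) (by norm_num)
    rw [log_pow, log_pow] at this
    exact_mod_cast this
  have h4 : log 4 = 2 * log (2 : ℝ) := by
    rw [show (4 : ℝ) = 2 ^ 2 by norm_num, log_pow]; norm_num
  have e : binEntropy (4 / 5) = log 5 - 8 / 5 * log 2 := by
    unfold binEntropy
    rw [show (1 - 4 / 5 : ℝ) = 1 / 5 by norm_num, log_inv, log_inv,
      log_div (by norm_num) (by norm_num), log_div (by norm_num) (by norm_num), log_one, h4]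
    ring
  have := log_pos (one_lt_two (α := ℝ))
  rw [e]
  linarith

/-- Concavity reduces the linear bound to its endpoints. The slope 17/35 is complementary to the
18/35 in `saving`. -/
lemma binEntropy_ge_of_mem_Icc {p : ℝ} (h : 2 / 7 ≤ p) (h1 : p ≤ 4 / 5) :
    (1 - 17 / 35 * p) * log 2 ≤ binEntropy p := by
  -- The factor 35/18 is the reciprocal of the interval length 4/5 - 2/7.
  have ha : 0 ≤ (4 / 5 - p) * (35 / 18) := by linarith
  have hb : 0 ≤ (p - 2 / 7) * (35 / 18) := by linarith
  have hc := strictConcave_binEntropy.concaveOn.2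
    (show (2 / 7 : ℝ) ∈ Set.Icc 0 1 by constructor <;> norm_num)
    (show (4 / 5 : ℝ) ∈ Set.Icc 0 1 by constructor <;> norm_num) ha hb (by ring)
  simp only [smul_eq_mul] at hc
  rw [show (4 / 5 - p) * (35 / 18) * (2 / 7) + (p - 2 / 7) * (35 / 18) * (4 / 5) = p by ring] at hc
  have a := mul_le_mul_of_nonneg_left binEntropy_two_sevenths ha
  have b := mul_le_mul_of_nonneg_left binEntropy_four_fifths hb
  linarith

lemma log_one_sub_le {x : ℝ} (h : |x| ≤ 2 / 7) :
    log (1 - x) ≤ -(x + x ^ 2 / 2 + x ^ 3 / 3 + x ^ 4 / 4 + x ^ 5 / 5 + x ^ 6 / 6 + x ^ 7 / 7)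
      + 7 / 5 * x ^ 8 := by
  have := le_of_abs_le (abs_log_sub_add_sum_range_le (x := x) (by linarith) 7)
  have h8 : |x| ^ (7 + 1) / (1 - |x|) ≤ 7 / 5 * x ^ 8 := by
    have e : |x| ^ (7 + 1) = x ^ 8 := by
      rw [show 7 + 1 = 2 * 4 by rfl, pow_mul, sq_abs, ← pow_mul]
    rw [e, div_le_iff₀ (by linarith)]
    nlinarith [show 0 ≤ x ^ 8 by positivity]
  norm_num [Finset.sum_range_succ] at this h8
  linarith

/-- The true quadratic coefficient is 1/(2 log 2) ≈ 0.721; rounding it up to 37/50 absorbs the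
higher-order terms. -/
lemma binEntropy_near_half {y : ℝ} (h : |y| ≤ 2 / 7) :
    (1 - 37 / 50 * y ^ 2) * log 2 ≤ binEntropy ((1 + y) / 2) := by
  obtain ⟨h1, h2⟩ := abs_le.1 h
  have e : binEntropy ((1 + y) / 2)
      = log 2 - ((1 + y) * log (1 - -y) + (1 - y) * log (1 - y)) / 2 := by
    unfold binEntropy
    rw [show (1 - (1 + y) / 2 : ℝ) = (1 - y) / 2 by ring, log_inv, log_inv,
      log_div (by linarith) (by norm_num), log_div (by linarith) (by norm_num), sub_neg_eq_add]
    ring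
  have a := mul_le_mul_of_nonneg_left (log_one_sub_le (x := -y) (by rwa [abs_neg]))
    (by linarith : 0 ≤ 1 + y)
  have b := mul_le_mul_of_nonneg_left (log_one_sub_le h) (by linarith : 0 ≤ 1 - y)
  have hs : y ^ 2 ≤ 4 / 49 := by nlinarith
  have hs0 := sq_nonneg y
  have h4 : y ^ 4 ≤ 4 / 49 * y ^ 2 := by nlinarith
  have h6 : y ^ 6 ≤ (4 / 49) * (4 / 49 * y ^ 2) := by nlinarith
  have h8 : y ^ 8 ≤ (4 / 49) * (4 / 49 * y ^ 2) := by nlinarith [sq_nonneg (y ^ 3)]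
  have l2 := log_two_gt_d9
  have : 37 / 50 * y ^ 2 * 0.693 ≤ 37 / 50 * y ^ 2 * log 2 :=
    mul_le_mul_of_nonneg_left (by linarith) (by positivity)
  rw [e]
  nlinarith

/-! ### Finding one weighted digit with redundancy at most one -/

/-- The function `x ↦ x log₂ x`. -/
noncomputable def xlog (x : ℝ) : ℝ := x * logb 2 x

lemma xlog_add {A B : ℝ} (hA : 0 < A) (hB : 0 < B) :
    xlog A + xlog B = xlog (A + B) - (A + B) * (binEntropy (A / (A + B)) / log 2) := by
  have h := log_pos (one_lt_two (α := ℝ))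
  unfold binEntropy xlog logb
  rw [show 1 - A / (A + B) = B / (A + B) by field_simp; ring, log_inv, log_inv,
    log_div hA.ne' (by positivity), log_div hB.ne' (by positivity)]
  field_simp
  ring

lemma xlog_add_le {A B c : ℝ} (hA : 0 < A) (hB : 0 < B)
    (h : c * log 2 ≤ binEntropy (A / (A + B))) :
    xlog A + xlog B ≤ xlog (A + B) - (A + B) * c := by
  rw [xlog_add hA hB]
  have := (le_div_iff₀ (log_pos (one_lt_two (α := ℝ)))).2 h
  have := mul_le_mul_of_nonneg_left this (by linarith : 0 ≤ A + B)
  linarith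

/-- The amount by which the redundancy of the one-digit strategy stays below one, for a total
weight `V` and a maximal weight `m`. -/
noncomputable def saving (V m : ℝ) : ℝ :=
  if m < 2 / 7 * V then 53 / 50 * m ^ 2 / V else if m ≤ 4 / 5 * V then 18 / 35 * m else 0

lemma saving_nonneg {V m : ℝ} (hV : 0 ≤ V) (hm : 0 ≤ m) : 0 ≤ saving V m := by
  unfold saving
  split_ifs <;> positivity

lemma saving_self {V : ℝ} (hV : 0 < V) : saving V V = 0 := by
  unfold saving
  rw [if_neg (by linarith), if_neg (by linarith)]

/-- The isolated digit needs no further questions, which frees an overhead of m. Up to ratio 4/5 the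
entropy deficit uses 17/35 of it and the rest is the saving; beyond that the deficit may use all of
it. -/
lemma equality_step {m B : ℝ} (hm : 0 < m) (hB : 0 < B) (h : 2 / 7 * (m + B) ≤ m) :
    xlog m + (xlog B + B) + (m + B) ≤ xlog (m + B) + (m + B) - saving (m + B) m := by
  have hV : 0 < m + B := by positivity
  unfold saving
  rw [if_neg (by linarith)]
  split_ifs with h1
  · have := xlog_add_le hm hB (binEntropy_ge_of_mem_Icc (p := m / (m + B))
      ((le_div_iff₀ hV).2 h) ((div_le_iff₀ hV).2 h1))
    have e : (m + B) * (1 - 17 / 35 * (m / (m + B))) = m + B - 17 / 35 * m := by field_simp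
    linarith
  · have := xlog_add_le hm hB (binEntropy_ge_of_half_le (p := m / (m + B))
      ((le_div_iff₀ hV).2 (by linarith)) ((div_lt_iff₀ hV).2 (by linarith)))
    have e : (m + B) * (1 - m / (m + B)) = B := by field_simp; ring
    linarith

lemma cut_step {m A B : ℝ} (hm : 0 < m) (hA : 0 < A) (hB : 0 < B) (h : m < 2 / 7 * (A + B))
    (hd : |A - B| ≤ m) :
    (xlog A + A - saving A m) + (xlog B + B) + (A + B)
      ≤ xlog (A + B) + (A + B) - saving (A + B) m := by
  have hV : 0 < A + B := by positivity
  obtain ⟨h1, h2⟩ := abs_le.1 hd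
  -- Here 9/5 = 37/50 + 53/50: the deficit of the cut plus the saving still owed for the whole set.
  have key : 9 / 5 * m ^ 2 / (A + B) ≤ saving A m := by
    unfold saving
    split_ifs with c1 c2
    · rw [div_le_div_iff₀ hV hA]
      nlinarith [sq_nonneg m]
    · rw [div_le_iff₀ hV]
      nlinarith
    -- Impossible case: A ≥ (A + B - m)/2 > 5/14 (A + B), so m < 4/5 A.
    · linarith
  have hy : |(A - B) / (A + B)| ≤ 2 / 7 := by
    rw [abs_div, abs_of_pos hV, div_le_iff₀ hV]
    linarith
  have := binEntropy_near_half hy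
  rw [show (1 + (A - B) / (A + B)) / 2 = A / (A + B) by field_simp; ring] at this
  have := xlog_add_le hA hB this
  have e : (A + B) * (1 - 37 / 50 * ((A - B) / (A + B)) ^ 2)
      = A + B - 37 / 50 * (A - B) ^ 2 / (A + B) := by field_simp
  have hs : (A - B) ^ 2 ≤ m ^ 2 := sq_le_sq' h1 h2
  have h3 : 37 / 50 * (A - B) ^ 2 / (A + B) ≤ 37 / 50 * m ^ 2 / (A + B) := by gcongr
  have h4 : saving (A + B) m = 53 / 50 * m ^ 2 / (A + B) := by
    unfold saving; rw [if_pos h]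
  have h5 : 9 / 5 * m ^ 2 / (A + B)
      = 37 / 50 * m ^ 2 / (A + B) + 53 / 50 * m ^ 2 / (A + B) := by ring
  linarith

/-- Two consecutive prefix sums enclose half the total and differ by at most m, so one of them is
within m/2 of half. -/
lemma exists_balanced_cut {D : Finset ℕ} {v : ℕ → ℝ} (hv : ∀ c ∈ D, 0 < v c) {m : ℝ}
    (hm : ∀ c ∈ D, v c ≤ m) (hD : D.Nonempty) :
    ∃ t, |∑ c ∈ D with c < t, v c - ∑ c ∈ D with ¬ c < t, v c| ≤ m := by
  classical
  set V := ∑ c ∈ D, v c with hVdef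
  have hV : 0 < V := Finset.sum_pos hv hD
  have split : ∀ t, ∑ c ∈ D with c < t, v c + ∑ c ∈ D with ¬ c < t, v c = V := fun t =>
    Finset.sum_filter_add_sum_filter_not D _ _
  have hex : ∃ t, V / 2 ≤ ∑ c ∈ D with c < t + 1, v c := by
    refine ⟨D.sup id, ?_⟩
    rw [Finset.filter_true_of_mem]
    · linarith
    · intro c hc
      exact Nat.lt_succ_of_le (Finset.le_sup (f := id) hc)
  obtain ⟨t, ht, hmin⟩ : ∃ t, V / 2 ≤ ∑ c ∈ D with c < t + 1, v c ∧
      ∑ c ∈ D with c < t, v c ≤ V / 2 := by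
    refine ⟨Nat.find hex, Nat.find_spec hex, ?_⟩
    rcases h : Nat.find hex with _ | s
    · simp; linarith
    · have := Nat.find_min hex (m := s) (by omega)
      linarith
  have hstep : ∑ c ∈ D with c < t + 1, v c ≤ ∑ c ∈ D with c < t, v c + m := by
    have hm0 : 0 ≤ m := by
      obtain ⟨c, hc⟩ := hD
      exact (hv c hc).le.trans (hm c hc)
    by_cases htD : t ∈ D
    · have : D.filter (· < t + 1) = insert t (D.filter (· < t)) := by
        ext c; simp only [Finset.mem_filter, Finset.mem_insert]
        constructor
        · rintro ⟨h1, h2⟩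
          by_cases c = t
          · exact Or.inl ‹_›
          · exact Or.inr ⟨h1, by omega⟩
        · rintro (rfl | ⟨h1, h2⟩)
          · exact ⟨htD, by omega⟩
          · exact ⟨h1, by omega⟩
      rw [this, Finset.sum_insert (by simp)]
      linarith [hm t htD]
    · have : D.filter (· < t + 1) = D.filter (· < t) := by
        ext c; simp only [Finset.mem_filter]
        refine and_congr_right fun h1 => ?_
        have : c ≠ t := fun h => htD (h ▸ h1)
        omega
      rw [this]
      linarith
  have s1 := split t
  have s2 := split (t + 1)
  by_cases hc : V - m ≤ 2 * ∑ c ∈ D with c < t, v c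
  · exact ⟨t, abs_le.2 ⟨by linarith, by linarith⟩⟩
  · exact ⟨t + 1, abs_le.2 ⟨by linarith, by linarith⟩⟩

/-- A splitting process on finite sets of weighted digits, with threshold and equality splits,
whose total excess over the entropy is at most the total weight. -/
lemma split_bound {v : ℕ → ℝ} {Pr : Finset ℕ → ℝ → Prop}
    (mono : ∀ D e e', e ≤ e' → Pr D e → Pr D e')
    (single : ∀ c, 0 < v c → Pr {c} (xlog (v c)))
    (cut : ∀ D t e e', (D.filter (· < t)).Nonempty → (D.filter (¬ · < t)).Nonempty →
      Pr (D.filter (· < t)) e → Pr (D.filter (¬ · < t)) e' → Pr D (e + e' + ∑ c ∈ D, v c))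
    (equal : ∀ D c e e', c ∈ D → (D.erase c).Nonempty →
      Pr {c} e → Pr (D.erase c) e' → Pr D (e + e' + ∑ c ∈ D, v c))
    (D : Finset ℕ) (hv : ∀ c ∈ D, 0 < v c) (m : ℝ) (hm : ∃ c ∈ D, v c = m)
    (hmax : ∀ c ∈ D, v c ≤ m) :
    Pr D (xlog (∑ c ∈ D, v c) + ∑ c ∈ D, v c - saving (∑ c ∈ D, v c) m) := by
  induction hN : D.card using Nat.strong_induction_on generalizing D m with
  | _ N ih =>
  subst hN
  have weak : ∀ E : Finset ℕ, E ⊂ D → E.Nonempty →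
      Pr E (xlog (∑ c ∈ E, v c) + ∑ c ∈ E, v c) := by
    intro E hE hne
    have hvE : ∀ c ∈ E, 0 < v c := fun c hc => hv c (hE.1 hc)
    obtain ⟨c, hc, hcm⟩ := E.exists_max_image v hne
    refine mono _ _ _ ?_ (ih _ (Finset.card_lt_card hE) E hvE (v c) ⟨c, hc, rfl⟩ hcm rfl)
    linarith [saving_nonneg (Finset.sum_pos hvE hne).le (hvE c hc).le]
  obtain ⟨c, hc, rfl⟩ := hm
  have hmpos := hv c hc
  have hVc : v c + ∑ x ∈ D.erase c, v x = ∑ x ∈ D, v x := Finset.add_sum_erase D v hc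
  by_cases hbig : 2 / 7 * ∑ x ∈ D, v x ≤ v c
  · rcases (D.erase c).eq_empty_or_nonempty with he | hne
    · rw [he, Finset.sum_empty, add_zero] at hVc
      have hD : D = {c} := by
        rw [← Finset.insert_erase hc, he]; rfl
      rw [← hVc, saving_self hmpos, hD]
      exact mono _ _ _ (by linarith) (single c hmpos)
    · refine mono _ _ _ ?_ (equal D c _ _ hc hne (single c hmpos)
        (weak _ (Finset.erase_ssubset hc) hne))
      rw [← hVc] at hbig ⊢
      exact equality_step hmpos
        (Finset.sum_pos (fun x hx => hv x (Finset.mem_of_mem_erase hx)) hne) hbig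
  · push Not at hbig
    obtain ⟨t, ht⟩ := exists_balanced_cut hv hmax ⟨c, hc⟩
    have hs := Finset.sum_filter_add_sum_filter_not D (· < t) v
    obtain ⟨ht1, ht2⟩ := abs_le.1 ht
    have hA : 0 < ∑ x ∈ D with x < t, v x := by linarith
    have hB : 0 < ∑ x ∈ D with ¬ x < t, v x := by linarith
    have neA : (D.filter (· < t)).Nonempty := Finset.nonempty_of_sum_ne_zero hA.ne'
    have neB : (D.filter (¬ · < t)).Nonempty := Finset.nonempty_of_sum_ne_zero hB.ne'
    have ssA : D.filter (· < t) ⊂ D := by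
      obtain ⟨x, hx⟩ := neB
      rw [Finset.mem_filter] at hx
      exact Finset.filter_ssubset.2 ⟨x, hx⟩
    have ssB : D.filter (¬ · < t) ⊂ D := by
      obtain ⟨x, hx⟩ := neA
      rw [Finset.mem_filter] at hx
      exact Finset.filter_ssubset.2 ⟨x, hx.1, not_not.2 hx.2⟩
    -- Only the side containing the heaviest digit needs its saving; the other side is bounded by
    -- `weak`.
    by_cases hct : c < t
    · refine mono _ _ _ ?_ (cut D t _ _ neA neB
        (ih _ (Finset.card_lt_card ssA) _ (fun x hx => hv x (ssA.1 hx)) (v c)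
          ⟨c, Finset.mem_filter.2 ⟨hc, hct⟩, rfl⟩ (fun x hx => hmax x (ssA.1 hx)) rfl)
        (weak _ ssB neB))
      rw [← hs] at hbig ⊢
      exact cut_step hmpos hA hB hbig ht
    · refine mono _ _ _ ?_ (cut D t _ _ neA neB (weak _ ssA neA)
        (ih _ (Finset.card_lt_card ssB) _ (fun x hx => hv x (ssB.1 hx)) (v c)
          ⟨c, Finset.mem_filter.2 ⟨hc, hct⟩, rfl⟩ (fun x hx => hmax x (ssB.1 hx)) rfl))
      rw [← hs, add_comm (∑ x ∈ D with x < t, v x)] at hbig ⊢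
      have := cut_step hmpos hB hA hbig (by rwa [abs_sub_comm])
      linarith

end TwentyQuestions

/-! ### Decision trees from digit questions -/

namespace TwentyQuestions

open Finset

/-- There is a decision tree with questions from `Q` that identifies the elements of `S`, has no
other leaves, and has total weighted depth at most `e`. -/
def Identifiable {n : ℕ} (Q : Finset (Finset (Fin n))) (w : Fin n → ℝ) (S : Finset (Fin n))
    (e : ℝ) : Prop :=
  ∃ T : DecisionTree n, T.leaves.Nodup ∧ (∀ x, x ∈ T.leaves ↔ x ∈ S) ∧
    (∀ x ∈ S, T.run x = x) ∧ T.Uses Q ∧ ∑ x ∈ S, w x * (T.depth x : ℝ) ≤ e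

section

variable {n : ℕ} {Q : Finset (Finset (Fin n))} {w : Fin n → ℝ} {S : Finset (Fin n)}

lemma Identifiable.mono {e e' : ℝ} (h : Identifiable Q w S e) (he : e ≤ e') :
    Identifiable Q w S e' := by
  obtain ⟨T, h1, h2, h3, h4, h5⟩ := h
  exact ⟨T, h1, h2, h3, h4, h5.trans he⟩

lemma identifiable_singleton (x : Fin n) : Identifiable Q w {x} 0 :=
  ⟨.leaf x, by simp [DecisionTree.leaves], by simp [DecisionTree.leaves],
    by simp [DecisionTree.run], by simp [DecisionTree.Uses], by simp [DecisionTree.depth]⟩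

lemma identifiable_node {q : Finset (Fin n)} (hq : q ∈ Q) {e e' : ℝ}
    (hy : Identifiable Q w (S.filter (· ∈ q)) e) (hn : Identifiable Q w (S.filter (· ∉ q)) e') :
    Identifiable Q w S (e + e' + ∑ x ∈ S, w x) := by
  obtain ⟨T, a1, a2, a3, a4, a5⟩ := hy
  obtain ⟨T', b1, b2, b3, b4, b5⟩ := hn
  simp only [mem_filter] at a2 b2 a3 b3
  refine ⟨.node q T T', ?_, ?_, ?_, ⟨hq, a4, b4⟩, ?_⟩
  · refine List.nodup_append'.2 ⟨a1, b1, ?_⟩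
    intro x hx hx'
    exact ((b2 x).1 hx').2 ((a2 x).1 hx).2
  · intro x
    simp only [DecisionTree.leaves, List.mem_append, a2, b2]
    tauto
  · intro x hx
    simp only [DecisionTree.run]
    split_ifs with h
    · exact a3 x ⟨hx, h⟩
    · exact b3 x ⟨hx, h⟩
  · have : ∑ x ∈ S, w x * ((DecisionTree.node q T T').depth x : ℝ)
        = ∑ x ∈ S with x ∈ q, w x * (T.depth x : ℝ)
          + ∑ x ∈ S with x ∉ q, w x * (T'.depth x : ℝ) + ∑ x ∈ S, w x := by
      rw [sum_filter, sum_filter, ← sum_add_distrib, ← sum_add_distrib]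
      refine sum_congr rfl fun x _ => ?_
      simp only [DecisionTree.depth]
      split_ifs <;> push_cast <;> ring
    linarith

/-- The entropy of the weights on `S`, scaled by their sum. -/
noncomputable def weightEntropy (w : Fin n → ℝ) (S : Finset (Fin n)) : ℝ :=
  xlog (∑ x ∈ S, w x) - ∑ x ∈ S, xlog (w x)

/-- This is the chain rule: determining the digit `d` costs one more unit of redundancy than the
fibers do. -/
lemma identifiable_of_fibers (hw : ∀ x ∈ S, 0 < w x) (hS : S.Nonempty) {d : Fin n → ℕ} {b : ℕ}
    (hd : ∀ x, d x < b)
    (hlt : ∀ c, 1 ≤ c → c < b → univ.filter (fun x => d x < c) ∈ Q)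
    (heq : ∀ c, 1 ≤ c → c < b → univ.filter (fun x => d x = c) ∈ Q) {k : ℝ}
    (hfib : ∀ c, (S.filter (d · = c)).Nonempty → Identifiable Q w (S.filter (d · = c))
      (weightEntropy w (S.filter (d · = c)) + k * ∑ x ∈ S with d x = c, w x)) :
    Identifiable Q w S (weightEntropy w S + (k + 1) * ∑ x ∈ S, w x) := by
  set v : ℕ → ℝ := fun c => ∑ x ∈ S with d x = c, w x with hvdef
  have fibers : ∀ D : Finset ℕ, ∑ c ∈ D, v c = ∑ x ∈ S with d x ∈ D, w x := by
    intro D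
    rw [← sum_fiberwise_of_maps_to (s := S.filter (d · ∈ D)) (t := D) (g := d)
      (fun x hx => (mem_filter.1 hx).2)]
    refine sum_congr rfl fun c hc => sum_congr ?_ fun _ _ => rfl
    ext x
    simp only [mem_filter]
    exact ⟨fun h => ⟨⟨h.1, h.2 ▸ hc⟩, h.2⟩, fun h => ⟨h.1.1, h.2⟩⟩
  -- Being additive over splits, this offset turns costs within S into the form that `split_bound`
  -- handles.
  set off : Finset (Fin n) → ℝ := fun R => k * ∑ x ∈ R, w x - ∑ x ∈ R, xlog (w x) with hoff
  have off_split : ∀ (R q : Finset (Fin n)),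
      off (R.filter (· ∈ q)) + off (R.filter (· ∉ q)) = off R := by
    intro R q
    simp only [hoff]
    rw [← sum_filter_add_sum_filter_not R (· ∈ q) w,
      ← sum_filter_add_sum_filter_not R (· ∈ q) (fun x => xlog (w x))]
    ring
  set Pr : Finset ℕ → ℝ → Prop := fun D e => D ⊆ range b →
    Identifiable Q w (S.filter (d · ∈ D)) (e + off (S.filter (d · ∈ D))) with hPr
  have node : ∀ (D E F : Finset ℕ) (q : Finset (Fin n)) (e e' : ℝ), q ∈ Q →
      (∀ x, d x ∈ E ↔ d x ∈ D ∧ x ∈ q) → (∀ x, d x ∈ F ↔ d x ∈ D ∧ x ∉ q) →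
      E ⊆ D → F ⊆ D → D ⊆ range b → Pr E e → Pr F e' → Pr D (e + e' + ∑ c ∈ D, v c) := by
    intro D E F q e e' hq hE hF hED hFD hDb h1 h2 _
    have h1 := h1 (hED.trans hDb)
    have h2 := h2 (hFD.trans hDb)
    have eE : S.filter (d · ∈ E) = (S.filter (d · ∈ D)).filter (· ∈ q) := by
      ext x; simp only [mem_filter, hE, and_assoc]
    have eF : S.filter (d · ∈ F) = (S.filter (d · ∈ D)).filter (· ∉ q) := by
      ext x; simp only [mem_filter, hF, and_assoc]
    rw [eE] at h1
    rw [eF] at h2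
    refine (identifiable_node hq h1 h2).mono (le_of_eq ?_)
    rw [fibers, ← off_split (S.filter (d · ∈ D)) q]
    ring
  have main := split_bound (v := v) (Pr := Pr)
    (fun D e e' h hp hD => (hp hD).mono (by linarith))
    (by
      intro c hc _
      have hne : (S.filter (d · = c)).Nonempty := nonempty_of_sum_ne_zero hc.ne'
      simp only [mem_singleton]
      refine (hfib c hne).mono (le_of_eq ?_)
      simp only [weightEntropy, hoff, hvdef]
      ring)
    (by
      intro D t e e' h1 h2 p1 p2 hDb
      obtain ⟨i, hi⟩ := h1
      obtain ⟨j, hj⟩ := h2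
      rw [mem_filter] at hi hj
      have hjb := mem_range.1 (hDb hj.1)
      refine node D _ _ _ e e' (hlt t (by omega) (by omega)) ?_ ?_ (filter_subset _ _)
        (filter_subset _ _) hDb p1 p2 hDb
      · intro x; simp
      · intro x; simp)
    (by
      intro D c e e' hc hne p1 p2 hDb
      have hcb := mem_range.1 (hDb hc)
      obtain ⟨j, hj⟩ := hne
      have hjb := mem_range.1 (hDb (mem_of_mem_erase hj))
      have hjc := ne_of_mem_erase hj
      have hq : univ.filter (fun x => d x = c) ∈ Q := by
        rcases Nat.eq_zero_or_pos c with rfl | h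
        -- Equality with 0 is the threshold question at 1, so b - 1 equality questions per digit
        -- suffice.
        · have := hlt 1 le_rfl (by omega)
          simpa only [Nat.lt_one_iff] using this
        · exact heq c h hcb
      refine node D _ _ _ e e' hq ?_ ?_ (singleton_subset_iff.2 hc) (erase_subset _ _) hDb p1 p2
        hDb
      · intro x
        simp only [mem_singleton, mem_filter, mem_univ, true_and]
        exact ⟨fun h => ⟨h ▸ hc, h⟩, fun h => h.2⟩
      · intro x
        simp only [mem_erase, mem_filter, mem_univ, true_and]
        tauto)
    (S.image d)
    (by
      intro c hc
      obtain ⟨x, hx, rfl⟩ := mem_image.1 hc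
      exact sum_pos (fun y hy => hw y (mem_filter.1 hy).1) ⟨x, mem_filter.2 ⟨hx, rfl⟩⟩)
  have hvpos : ∀ c, 0 ≤ v c := fun c => sum_nonneg fun y hy => (hw y (mem_filter.1 hy).1).le
  obtain ⟨c, hc, hmax⟩ := (S.image d).exists_max_image v (hS.image d)
  have := main (v c) ⟨c, hc, rfl⟩ hmax (by
    intro c hc
    obtain ⟨x, hx, rfl⟩ := mem_image.1 hc
    exact mem_range.2 (hd x))
  have hSS : S.filter (d · ∈ S.image d) = S :=
    filter_true_of_mem fun x hx => mem_image_of_mem d hx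
  rw [fibers, hSS] at this
  refine this.mono ?_
  have := saving_nonneg (sum_nonneg fun x hx => (hw x hx).le : 0 ≤ ∑ x ∈ S, w x) (hvpos c)
  simp only [weightEntropy, hoff]
  linarith

end

/-- Threshold and equality questions about the first `k` digits in base `b`. -/
def digitQuestions (n b k : ℕ) : Finset (Finset (Fin n)) :=
  (range k).biUnion fun j =>
    (Ico 1 b).image (fun c => univ.filter fun x : Fin n => x.val / b ^ j % b < c) ∪
    (Ico 1 b).image (fun c => univ.filter fun x : Fin n => x.val / b ^ j % b = c)

lemma card_digitQuestions_le (n b k : ℕ) : (digitQuestions n b k).card ≤ 2 * k * (b - 1) := by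
  refine card_biUnion_le.trans ?_
  refine (sum_le_card_nsmul _ _ (2 * (b - 1)) fun j _ => ?_).trans
    (le_of_eq (by rw [card_range, smul_eq_mul]; ring))
  refine (card_union_le _ _).trans ?_
  have h1 := card_image_le (s := Ico 1 b)
    (f := fun c => univ.filter fun x : Fin n => x.val / b ^ j % b < c)
  have h2 := card_image_le (s := Ico 1 b)
    (f := fun c => univ.filter fun x : Fin n => x.val / b ^ j % b = c)
  rw [Nat.card_Ico] at h1 h2
  omega

/-- Digits are determined from the most significant down: fixing digit j reduces the unknown part to
the lower j digits. -/
lemma identifiable_digitQuestions {n b k : ℕ} {w : Fin n → ℝ} (hb : 0 < b) (j : ℕ) (hj : j ≤ k)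
    (S : Finset (Fin n)) (hS : S.Nonempty) (hw : ∀ x ∈ S, 0 < w x)
    (hconst : ∀ x ∈ S, ∀ y ∈ S, x.val / b ^ j = y.val / b ^ j) :
    Identifiable (digitQuestions n b k) w S (weightEntropy w S + j * ∑ x ∈ S, w x) := by
  induction j generalizing S with
  | zero =>
    obtain ⟨x, hx⟩ := hS
    have : S = {x} := eq_singleton_iff_unique_mem.2 ⟨hx, fun y hy => Fin.ext (by
      simpa using hconst y hy x hx)⟩
    subst this
    refine (identifiable_singleton x).mono (by simp [weightEntropy])
  | succ j ih =>
    push_cast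
    refine identifiable_of_fibers (d := fun x => x.val / b ^ j % b) (b := b) hw hS
      (fun x => Nat.mod_lt _ hb) ?_ ?_ ?_
    · intro c h1 h2
      exact mem_biUnion.2 ⟨j, mem_range.2 hj, mem_union_left _
        (mem_image.2 ⟨c, mem_Ico.2 ⟨h1, h2⟩, rfl⟩)⟩
    · intro c h1 h2
      exact mem_biUnion.2 ⟨j, mem_range.2 hj, mem_union_right _
        (mem_image.2 ⟨c, mem_Ico.2 ⟨h1, h2⟩, rfl⟩)⟩
    · intro c hne
      refine ih (by omega) _ hne (fun x hx => hw x (mem_filter.1 hx).1) ?_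
      intro x hx y hy
      rw [mem_filter] at hx hy
      have := hconst x hx.1 y hy.1
      rw [pow_succ, ← Nat.div_div_eq_div_mul, ← Nat.div_div_eq_div_mul] at this
      rw [← Nat.div_add_mod (x.val / b ^ j) b, ← Nat.div_add_mod (y.val / b ^ j) b, this, hx.2,
        hy.2]

lemma redundancyAtMost_digitQuestions {n b k : ℕ} (hk : k ≠ 0) (hb : n ≤ b ^ k) {r : ℝ}
    (hr : (k : ℝ) ≤ r) : RedundancyAtMost (digitQuestions n b k) r := by
  intro μ hμ
  obtain ⟨h0, h1⟩ := hμ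
  set S := univ.filter (fun x => μ x ≠ 0) with hSdef
  have hmem : ∀ x, x ∈ S ↔ μ x ≠ 0 := fun x => by simp [hSdef]
  have extend : ∀ f : Fin n → ℝ, (∀ x, μ x = 0 → f x = 0) → ∑ x ∈ S, f x = ∑ x, f x := by
    intro f hf
    refine sum_subset (subset_univ _) fun x _ hx => hf x ?_
    rwa [hmem, not_not] at hx
  have hsum : ∑ x ∈ S, μ x = 1 := by rw [extend μ fun _ h => h, h1]
  have hS : S.Nonempty := nonempty_of_sum_ne_zero (by rw [hsum]; exact one_ne_zero)
  have hw : ∀ x ∈ S, 0 < μ x := fun x hx => lt_of_le_of_ne (h0 x) (Ne.symm ((hmem x).1 hx))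
  have hb0 : 0 < b := by
    rcases Nat.eq_zero_or_pos b with rfl | h
    · obtain ⟨x, -⟩ := hS
      rw [zero_pow hk] at hb
      exact absurd x.isLt (by omega)
    · exact h
  obtain ⟨T, t1, t2, t3, t4, t5⟩ := identifiable_digitQuestions hb0 k le_rfl S hS hw (by
    intro x _ y _
    rw [Nat.div_eq_of_lt (x.isLt.trans_le hb), Nat.div_eq_of_lt (y.isLt.trans_le hb)])
  refine ⟨T, ⟨t1, fun x => (t2 x).trans (hmem x), fun x hx => t3 x ((hmem x).2 hx)⟩, t4, ?_⟩
  have e1 : T.cost μ = ∑ x ∈ S, μ x * (T.depth x : ℝ) :=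
    (extend (fun x => μ x * (T.depth x : ℝ)) fun x hx => by simp [hx]).symm
  have e2 : entropy μ = weightEntropy μ S := by
    rw [weightEntropy, hsum, extend (fun x => xlog (μ x)) fun x hx => by simp [hx, xlog]]
    simp [entropy, xlog]
  rw [hsum] at t5
  linarith

end TwentyQuestions

/-! ### Lower bound by the polynomial dimension argument -/

namespace TwentyQuestions

open Finset

/-- The span of the products of at most `k` indicator functions of sets in `Q`. -/
def productSpan {n : ℕ} (Q : Finset (Finset (Fin n))) (k : ℕ) : Submodule ℝ (Fin n → ℝ) :=
  Submodule.span ℝ ((fun (I : Finset (Finset (Fin n))) (y : Fin n) =>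
    ∏ q ∈ I, if y ∈ q then (1 : ℝ) else 0) '' {I | I ⊆ Q ∧ I.card ≤ k})

section

variable {n : ℕ} {Q : Finset (Finset (Fin n))}

lemma productSpan_mono {j k : ℕ} (h : j ≤ k) : productSpan Q j ≤ productSpan Q k :=
  Submodule.span_mono (Set.image_mono fun _ hI => ⟨hI.1, hI.2.trans h⟩)

lemma one_mem_productSpan (k : ℕ) : (fun _ => 1) ∈ productSpan Q k :=
  Submodule.subset_span ⟨∅, ⟨empty_subset _, by simp⟩, by simp⟩

lemma indicator_mul_mem_productSpan {q : Finset (Fin n)} (hq : q ∈ Q) {k : ℕ} {f : Fin n → ℝ}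
    (hf : f ∈ productSpan Q k) :
    (fun y => (if y ∈ q then (1 : ℝ) else 0) * f y) ∈ productSpan Q (k + 1) := by
  induction hf using Submodule.span_induction with
  | mem f hf =>
    obtain ⟨I, ⟨hI, hIk⟩, rfl⟩ := hf
    refine Submodule.subset_span ⟨insert q I, ⟨insert_subset hq hI,
      (card_insert_le _ _).trans (by omega)⟩, ?_⟩
    funext y
    by_cases hqI : q ∈ I
    · rw [insert_eq_of_mem hqI]
      simp only [← mul_prod_erase I _ hqI]
      split_ifs <;> simp
    · simp only [prod_insert hqI]
  | zero =>
    simp only [Pi.zero_apply, mul_zero]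
    exact (productSpan Q (k + 1)).zero_mem
  | add f g _ _ h1 h2 =>
    simp only [Pi.add_apply, mul_add]
    exact Submodule.add_mem _ h1 h2
  | smul a f _ h =>
    have := Submodule.smul_mem _ a h
    convert this using 1
    funext y
    simp only [Pi.smul_apply, smul_eq_mul]
    ring

/-- The function is the product, along the path of x, of the indicators of the questions or their
complements. -/
lemma exists_mem_productSpan_of_run (T : DecisionTree n) (hT : T.Uses Q) (x : Fin n) :
    ∃ f ∈ productSpan Q (T.depth x), f x = 1 ∧ ∀ y, f y ≠ 0 → T.run y = T.run x := by
  induction T with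
  | leaf z => exact ⟨fun _ => 1, one_mem_productSpan _, rfl, fun _ _ => rfl⟩
  | node q T T' ih ih' =>
    obtain ⟨hq, h1, h2⟩ := hT
    by_cases hx : x ∈ q
    · obtain ⟨f, f1, f2, f3⟩ := ih h1
      refine ⟨fun y => (if y ∈ q then (1 : ℝ) else 0) * f y, ?_, by simp [hx, f2], ?_⟩
      · simpa [DecisionTree.depth, hx, add_comm] using indicator_mul_mem_productSpan hq f1
      · intro y hy
        have hyq : y ∈ q := by by_contra h; simp [h] at hy
        simpa [DecisionTree.run, hx, hyq] using f3 y (right_ne_zero_of_mul hy)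
    · obtain ⟨f, f1, f2, f3⟩ := ih' h2
      refine ⟨f - fun y => (if y ∈ q then (1 : ℝ) else 0) * f y, ?_, by simp [hx, f2], ?_⟩
      · simpa [DecisionTree.depth, hx, add_comm] using Submodule.sub_mem _
          (productSpan_mono (Nat.le_succ _) f1) (indicator_mul_mem_productSpan hq f1)
      · intro y hy
        have hyq : y ∉ q := by intro h; simp [h] at hy
        have : f y ≠ 0 := by simpa [hyq] using hy
        simpa [DecisionTree.run, hx, hyq] using f3 y this

lemma exists_shallow_tree {r : ℝ} {k : ℕ} (hk : r < k + 1) (hQ : RedundancyAtMost Q r)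
    (x : Fin n) :
    ∃ T : DecisionTree n, T.Uses Q ∧ T.depth x ≤ k ∧ ∀ y, T.run y = y := by
  have hn : (0 : ℝ) < n := by exact_mod_cast x.pos
  set μ : ℝ → Fin n → ℝ := fun s y => (1 - s) * (if y = x then 1 else 0) + s * (1 / n) with hμ
  have hmem : ∀ s, 0 ≤ s → s ≤ 1 → μ s ∈ stdSimplex ℝ (Fin n) := by
    intro s h0 h1
    refine ⟨fun y => ?_, ?_⟩
    · have : (0 : ℝ) ≤ if y = x then 1 else 0 := by split_ifs <;> norm_num
      have := mul_nonneg (sub_nonneg.2 h1) this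
      simp only [hμ]
      positivity
    · simp only [hμ, sum_add_distrib, ← mul_sum, sum_ite_eq', mem_univ, if_true, sum_const,
        card_univ, Fintype.card_fin, nsmul_eq_mul]
      field_simp
      ring
  have hcont : Continuous fun s => entropy (μ s) := by
    have : (fun s => entropy (μ s)) = fun s => ∑ y, Real.negMulLog (μ s y) / Real.log 2 := by
      funext s
      simp only [entropy, Real.negMulLog, Real.logb]
      exact sum_congr rfl fun y _ => by ring
    rw [this]
    refine continuous_finsetSum _ fun y _ => (Real.continuous_negMulLog.comp ?_).div_const _
    simp only [hμ]
    fun_prop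
  have h0 : entropy (μ 0) = 0 := by
    refine sum_eq_zero fun y _ => ?_
    by_cases h : y = x <;> simp [hμ, h]
  have hev : ∀ᶠ s in nhdsWithin (0 : ℝ) (Set.Ioi 0), entropy (μ s) + r < (1 - s) * (k + 1) := by
    have hc : Continuous fun s : ℝ => (1 - s) * (k + 1) - (entropy (μ s) + r) := by fun_prop
    have : ∀ᶠ s in nhds (0 : ℝ), 0 < (1 - s) * (k + 1) - (entropy (μ s) + r) :=
      hc.continuousAt.eventually (lt_mem_nhds (by simp only [h0]; linarith))
    filter_upwards [nhdsWithin_le_nhds this] with s hs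
    linarith
  -- Positive s gives full support, while small s makes a depth of k + 1 at x too expensive.
  obtain ⟨s, hs, hs0, hs1⟩ := (hev.and (Ioo_mem_nhdsGT (zero_lt_one (α := ℝ)))).exists
  have hpos : ∀ y, 0 < μ s y := by
    intro y
    have : (0 : ℝ) ≤ if y = x then 1 else 0 := by split_ifs <;> norm_num
    have := mul_nonneg (sub_nonneg.2 hs1.le) this
    simp only [hμ]
    positivity
  obtain ⟨T, hT, hU, hcost⟩ := hQ (μ s) (hmem s hs0.le hs1.le)
  refine ⟨T, hU, ?_, fun y => hT.run_eq y (hpos y).ne'⟩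
  by_contra hd
  push Not at hd
  have hd' : (k : ℝ) + 1 ≤ T.depth x := by exact_mod_cast hd
  have h1 : μ s x * (T.depth x : ℝ) ≤ T.cost (μ s) :=
    single_le_sum (f := fun y => μ s y * (T.depth y : ℝ))
      (fun y _ => mul_nonneg (hpos y).le (Nat.cast_nonneg _)) (mem_univ x)
  have h2 : 1 - s ≤ μ s x := by
    simp only [hμ, if_true, mul_one]
    have : 0 ≤ s * (1 / n) := by positivity
    linarith
  have h3 : (1 - s) * ((k : ℝ) + 1) ≤ μ s x * (T.depth x : ℝ) :=
    mul_le_mul h2 hd' (by positivity) (hpos x).le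
  linarith

lemma productSpan_eq_top {r : ℝ} {k : ℕ} (hk : r < k + 1) (hQ : RedundancyAtMost Q r) :
    productSpan Q k = ⊤ := by
  rw [eq_top_iff, ← (Pi.basisFun ℝ (Fin n)).span_eq, Submodule.span_le]
  rintro _ ⟨x, rfl⟩
  obtain ⟨T, hU, hd, hrun⟩ := exists_shallow_tree hk hQ x
  obtain ⟨f, f1, f2, f3⟩ := exists_mem_productSpan_of_run T hU x
  have : Pi.basisFun ℝ (Fin n) x = f := by
    funext y
    rw [Pi.basisFun_apply]
    by_cases h : y = x
    · subst h; simp [f2]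
    · rw [Pi.single_eq_of_ne h]
      by_contra hf
      have := f3 y (Ne.symm hf)
      rw [hrun, hrun] at this
      exact h this
  rw [this]
  exact productSpan_mono hd f1

lemma le_card_of_redundancyAtMost {r : ℝ} {k : ℕ} (hk : r < k + 1)
    (hQ : RedundancyAtMost Q r) : n ≤ (Q.powerset.filter (·.card ≤ k)).card := by
  have h := productSpan_eq_top hk hQ
  have e : {I | I ⊆ Q ∧ I.card ≤ k} = (Q.powerset.filter (·.card ≤ k) : Set _) := by
    ext I; simp
  rw [productSpan, e, ← coe_image] at h
  have h2 := (finrank_span_finset_le_card (R := ℝ) ((Q.powerset.filter (·.card ≤ k)).image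
    fun (I : Finset (Finset (Fin n))) (y : Fin n) => ∏ q ∈ I, if y ∈ q then (1 : ℝ) else 0))
  rw [Set.finrank, h, finrank_top, Module.finrank_fin_fun] at h2
  exact h2.trans card_image_le

end

/-! ### Counting small subsets, and the two bounds -/

/-- In the expansion of (1 + t)^|Q| over subsets, each small subset contributes at least t^k because
t ≤ 1. -/
lemma card_filter_card_le_mul_pow_le {α : Type*} (Q : Finset α) (k : ℕ) {t : ℝ} (h0 : 0 ≤ t)
    (h1 : t ≤ 1) : ((Q.powerset.filter (·.card ≤ k)).card : ℝ) * t ^ k ≤ (1 + t) ^ Q.card := by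
  have := sum_pow_mul_eq_add_pow t 1 Q
  simp only [one_pow, mul_one] at this
  rw [add_comm, ← this, ← nsmul_eq_mul]
  refine (card_nsmul_le_sum _ (fun I => t ^ I.card) _ fun I hI => ?_).trans
    (sum_le_sum_of_subset_of_nonneg (filter_subset _ _) fun I _ _ => pow_nonneg h0 _)
  exact pow_le_pow_of_le_one h0 h1 (mem_filter.1 hI).2

lemma lower_bound {n k : ℕ} {Q : Finset (Finset (Fin n))} {r : ℝ} (hk0 : k ≠ 0) (hk : r < k + 1)
    (hkn : k ≤ Nat.clog 2 n) (hQ : RedundancyAtMost Q r) :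
    1 / Real.exp 1 * (k : ℝ) * (n : ℝ) ^ (1 / (k : ℝ)) ≤ Q.card := by
  have hcard := le_card_of_redundancyAtMost hk hQ
  -- From n ≤ 2^|Q|; this is where the hypothesis on ⌈log₂ n⌉ enters, and it makes t = k/|Q| at most
  -- 1.
  have hkQ : k ≤ Q.card := by
    refine hkn.trans (Nat.clog_le_of_le_pow ?_)
    rw [← card_powerset]
    exact hcard.trans (card_filter_le _ _)
  have hkpos : (0 : ℝ) < k := by exact_mod_cast Nat.pos_of_ne_zero hk0
  have hN : (0 : ℝ) < Q.card := hkpos.trans_le (by exact_mod_cast hkQ)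
  have hb := card_filter_card_le_mul_pow_le Q k (t := k / Q.card) (by positivity)
    ((div_le_one hN).2 (by exact_mod_cast hkQ))
  have h1 : (1 + (k : ℝ) / Q.card) ^ Q.card ≤ Real.exp 1 ^ k := by
    rw [← Real.exp_nat_mul, mul_one]
    calc (1 + (k : ℝ) / Q.card) ^ Q.card ≤ Real.exp (k / Q.card) ^ Q.card := by
          gcongr
          rw [add_comm]
          exact Real.add_one_le_exp _
      _ = Real.exp k := by
          rw [← Real.exp_nat_mul]
          congr 1
          field_simp
  have h2 : (n : ℝ) ≤ (Real.exp 1 * Q.card / k) ^ k := by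
    have hpos : (0 : ℝ) < (k / Q.card : ℝ) ^ k := by positivity
    have h3 : (n : ℝ) * (k / Q.card : ℝ) ^ k ≤ Real.exp 1 ^ k :=
      (mul_le_mul_of_nonneg_right (by exact_mod_cast hcard) hpos.le).trans (hb.trans h1)
    rw [← le_div_iff₀ hpos, ← div_pow] at h3
    refine h3.trans (le_of_eq ?_)
    congr 1
    field_simp
  have h4 : (n : ℝ) ^ (1 / (k : ℝ)) ≤ Real.exp 1 * Q.card / k := by
    rw [one_div]
    refine (Real.rpow_le_rpow (Nat.cast_nonneg n) h2 (by positivity)).trans (le_of_eq ?_)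
    exact Real.pow_rpow_inv_natCast (by positivity) hk0
  calc 1 / Real.exp 1 * (k : ℝ) * (n : ℝ) ^ (1 / (k : ℝ))
      ≤ 1 / Real.exp 1 * (k : ℝ) * (Real.exp 1 * Q.card / k) := by gcongr
    _ = Q.card := by field_simp

lemma upper_bound (n : ℕ) {k : ℕ} (hk : k ≠ 0) {r : ℝ} (hr : (k : ℝ) ≤ r) :
    ∃ Q : Finset (Finset (Fin n)), RedundancyAtMost Q r ∧
      (Q.card : ℝ) ≤ 2 * (k : ℝ) * (n : ℝ) ^ (1 / (k : ℝ)) := by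
  set y := (n : ℝ) ^ (1 / (k : ℝ)) with hy
  have hy0 : 0 ≤ y := by positivity
  refine ⟨digitQuestions n ⌈y⌉₊ k, redundancyAtMost_digitQuestions hk ?_ hr, ?_⟩
  · have : (n : ℝ) ≤ (⌈y⌉₊ : ℝ) ^ k := by
      calc (n : ℝ) = y ^ k := by
            rw [hy, one_div, Real.rpow_inv_natCast_pow (Nat.cast_nonneg n) hk]
        _ ≤ _ := by gcongr; exact Nat.le_ceil y
    exact_mod_cast this
  -- The -1 offsets the rounding up of the base, so the constant stays exactly 2. For n = 0 the
  -- subtraction truncates to 0.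
  · have h1 : ((⌈y⌉₊ - 1 : ℕ) : ℝ) ≤ y := by
      rcases Nat.eq_zero_or_pos ⌈y⌉₊ with h | h
      · simpa [h] using hy0
      · rw [Nat.cast_sub h]
        have := Nat.ceil_lt_add_one hy0
        push_cast
        linarith
    have h2 : ((digitQuestions n ⌈y⌉₊ k).card : ℝ) ≤ 2 * k * ((⌈y⌉₊ - 1 : ℕ) : ℝ) := by
      exact_mod_cast card_digitQuestions_le n ⌈y⌉₊ k
    exact h2.trans (by gcongr)

end TwentyQuestions

theorem mainTheorem2 (r : ℝ) (hr : 1 ≤ r) :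
    (∀ n : ℕ,
      -- the minimum defining `uH n r` is attained
      IsLeast (TwentyQuestions.redundancySizes n r) (TwentyQuestions.uH n r) ∧
      -- upper bound
      (TwentyQuestions.uH n r : ℝ) ≤ 2 * (⌊r⌋₊ : ℝ) * (n : ℝ) ^ (1 / (⌊r⌋₊ : ℝ)) ∧
      -- lower bound; `Nat.clog 2 n` is `⌈log₂ n⌉`
      (⌊r⌋₊ ≤ Nat.clog 2 n →
        (1 / Real.exp 1) * (⌊r⌋₊ : ℝ) * (n : ℝ) ^ (1 / (⌊r⌋₊ : ℝ)) ≤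
          (TwentyQuestions.uH n r : ℝ))) ∧
    Asymptotics.IsTheta Filter.atTop
      (fun n : ℕ => (TwentyQuestions.uH n r : ℝ))
      (fun n : ℕ => (⌊r⌋₊ : ℝ) * (n : ℝ) ^ (1 / (⌊r⌋₊ : ℝ))) := by
  have hk0 : ⌊r⌋₊ ≠ 0 := (Nat.floor_pos.2 hr).ne'
  have bounds : ∀ n : ℕ,
      IsLeast (TwentyQuestions.redundancySizes n r) (TwentyQuestions.uH n r) ∧
      (TwentyQuestions.uH n r : ℝ) ≤ 2 * (⌊r⌋₊ : ℝ) * (n : ℝ) ^ (1 / (⌊r⌋₊ : ℝ)) ∧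
      (⌊r⌋₊ ≤ Nat.clog 2 n →
        (1 / Real.exp 1) * (⌊r⌋₊ : ℝ) * (n : ℝ) ^ (1 / (⌊r⌋₊ : ℝ)) ≤
          (TwentyQuestions.uH n r : ℝ)) := by
    intro n
    obtain ⟨Q, hQ, hcard⟩ := TwentyQuestions.upper_bound n hk0 (Nat.floor_le (by linarith))
    have hmem : TwentyQuestions.uH n r ∈ TwentyQuestions.redundancySizes n r :=
      Nat.sInf_mem ⟨_, Q, hQ, rfl⟩
    refine ⟨⟨hmem, fun _ h => Nat.sInf_le h⟩, ?_, fun hkn => ?_⟩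
    · have : TwentyQuestions.uH n r ≤ Q.card := Nat.sInf_le ⟨Q, hQ, rfl⟩
      exact le_trans (by exact_mod_cast this) hcard
    · obtain ⟨Q', hQ', h⟩ := hmem
      rw [← h]
      exact TwentyQuestions.lower_bound hk0 (Nat.lt_floor_add_one r) hkn hQ'
  refine ⟨bounds, ?_, ?_⟩
  · refine Asymptotics.IsBigO.of_bound 2 (Filter.Eventually.of_forall fun n => ?_)
    rw [Real.norm_of_nonneg (by positivity), Real.norm_of_nonneg (by positivity), ← mul_assoc]
    exact (bounds n).2.1
  · refine Asymptotics.IsBigO.of_bound (Real.exp 1) ?_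
    filter_upwards [Filter.eventually_ge_atTop (2 ^ ⌊r⌋₊)] with n hn
    rw [Real.norm_of_nonneg (by positivity), Real.norm_of_nonneg (by positivity)]
    have h := (bounds n).2.2 (by
      have := Nat.clog_mono_right 2 hn
      rwa [Nat.clog_pow _ _ one_lt_two] at this)
    rw [mul_assoc, one_div, inv_mul_le_iff₀ (Real.exp_pos 1)] at h
    exact h
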